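/- Let $m\ge 1$ be an integer, let $I=[a,b]$ be a compact interval, let $u\in\mathbb R$, and let $Y=(Y(t))_{t\in I}$ be a real-valued process on a probability space. For an interval $J\subset I$ let $Z^u_Y(J)=\mathrm{Card}\{t\in J: Y(t)=u\}$ be the number of crossings of the level $u$ on $J$, and let $Z_{Y'}(I)=\mathrm{Card}\{t\in I: Y'(t)=0\}$ (the derivative being one-sided at the end points of $I$). Write $x^{[m]}=x(x-1)\cdots(x-m+1)$. Assume that: A1. $Y$ has $\mathcal C^1$ sample paths on $I$; A2. for every $t\in I$ the variable $Y(t)$ has a density $p_{Y(t)}$, and $p_{Y(t)}(y)$ is bounded uniformly for $t\in I$ and $y$ in a neighborhood of $u$; A3. $\mathbb E[Z_{Y'}(I)^m]<\infty$; A4. for almost every $t=(t_1,\dots,t_m)\in I^m$ the vector $(Y(t_1),\dots,Y(t_m))$ has a density $p_{Y(t_1),\dots,Y(t_m)}$, and there are versions, jointly measurable in $(t,v)\in\mathbb R^m\times\mathbb R^m$ and fixed from now on, of the density $p_{Y(t_1),\dots,Y(t_m)}(v)$ and of the conditional expectation $\mathbb E\big(|Y'(t_1)|\cdots|Y'(t_m)|\,\big|\,Y(t_1)=v_1,\dots,Y(t_m)=v_m\big)\in[0,\infty]$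 such that, for any pairwise disjoint intervals $J_1,\dots,J_m$ included in $I$, the Rice function $$B_{J_1\times\cdots\times J_m}(v)=\int_{J_1\times\cdots\times J_m}\mathbb E\big(|Y'(t_1)|\cdots|Y'(t_m)|\,\big|\,Y(t_1)=v_1,\dots,Y(t_m)=v_m\big)\,p_{Y(t_1),\dots,Y(t_m)}(v)\,dt_1\cdots dt_m\in[0,\infty]$$ is continuous at $v=(u,\dots,u)$. Let $B_{I^m}(v)$ be given by the same integral over $I^m$. Then $Y$ satisfies the $m$-th Rice formula: (i) for any pairwise disjoint intervals $J_1,\dots,J_m$ included in $I$, $$\mathbb E\big[Z^u_Y(J_1)\times\cdots\times Z^u_Y(J_m)\big]=B_{J_1\times\cdots\times J_m}(u,\dots,u);$$ (ii) $\mathbb E\big[Z^u_Y(I)^{[m]}\big]=B_{I^m}(u,\dots,u)$. All these expectations exist and are finite. -/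

import Mathlib

open MeasureTheory ProbabilityTheory Set Filter Topology
open scoped ENNReal NNReal

namespace Rice

/-- The number (in `[0, ∞]`) of points `t ∈ J` with `f t = u`. -/
noncomputable def levelCount (f : ℝ → ℝ) (u : ℝ) (J : Set ℝ) : ℝ≥0∞ :=
  (({t ∈ J | f t = u} : Set ℝ).encard : ℝ≥0∞)

/-- The falling factorial `x (x - 1) ⋯ (x - m + 1)`. The subtraction is truncated; for a natural
number `x < m` one of the factors is zero, as it should be. -/
noncomputable def fallingFactorial (x : ℝ≥0∞) (m : ℕ) : ℝ≥0∞ :=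
  ∏ k ∈ Finset.range m, (x - (k : ℝ≥0∞))

/-- `q` is a (measurable) Lebesgue density of the law of the random vector (or variable) `V`. -/
def IsDensity {Ω E : Type*} [MeasurableSpace Ω] [MeasureSpace E] (P : Measure Ω) (V : Ω → E)
    (q : E → ℝ≥0∞) : Prop :=
  Measurable q ∧ P.map V = (volume : Measure E).withDensity q

/-- `e` is a version of the function `v ↦ 𝔼(R | V = v)`, where `R ≥ 0`: it is measurable, and
`e (V)` is almost surely equal to the conditional expectation of `R` given `σ(V)`. -/
def IsCondExpGiven {Ω E : Type*} [MeasurableSpace Ω] [mE : MeasurableSpace E] (P : Measure Ω)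
    (R : Ω → ℝ≥0∞) (V : Ω → E) (e : E → ℝ≥0∞) : Prop :=
  Measurable e ∧ (fun ω => e (V ω)) =ᵐ[P] condLExp (mE.comap V) P R

/-- The time derivative on the interval `I` (one-sided at the end points of `I`) of the path of
`Y` at `ω`. -/
noncomputable def pathDeriv {Ω : Type*} (Y : ℝ → Ω → ℝ) (I : Set ℝ) (ω : Ω) (t : ℝ) : ℝ :=
  derivWithin (fun s => Y s ω) I t

/-- The one-dimensional densities of `Y` are bounded, uniformly for times in `I` and for values
in a neighbourhood of `u`. -/
def HasBoundedDensitiesNear {Ω : Type*} [MeasurableSpace Ω] (P : Measure Ω) (Y : ℝ → Ω → ℝ)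
    (I : Set ℝ) (u : ℝ) : Prop :=
  ∃ C : ℝ≥0, ∃ U ∈ 𝓝 u, ∀ t ∈ I, ∃ q : ℝ → ℝ≥0∞,
    IsDensity P (Y t) q ∧ ∀ y ∈ U, q y ≤ C

/-- The functions `p` and `e` are jointly measurable versions of the density
`p t v = p_{Y(t₁), …, Y(tₘ)}(v)` and of the conditional expectation
`e t v = 𝔼(|Y'(t₁)| ⋯ |Y'(tₘ)| | Y(t₁) = v₁, …, Y(tₘ) = vₘ)`, for almost all times `t` in `Iᵐ`. -/
structure IsRiceVersion {Ω : Type*} [MeasurableSpace Ω] (P : Measure Ω) (Y : ℝ → Ω → ℝ)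
    (I : Set ℝ) {m : ℕ} (p e : (Fin m → ℝ) → (Fin m → ℝ) → ℝ≥0∞) : Prop where
  measurable_density : Measurable (Function.uncurry p)
  measurable_condExp : Measurable (Function.uncurry e)
  isDensity : ∀ᵐ t ∂(volume.restrict (Set.univ.pi fun _ : Fin m => I)),
    IsDensity P (fun ω i => Y (t i) ω) (p t)
  isCondExpGiven : ∀ᵐ t ∂(volume.restrict (Set.univ.pi fun _ : Fin m => I)),
    IsCondExpGiven P (fun ω => ∏ i, ‖pathDeriv Y I ω (t i)‖ₑ) (fun ω i => Y (t i) ω) (e t)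

/-- The Rice function `v ↦ B_{J₁ × ⋯ × Jₘ}(v)` built from the versions `p` and `e`. -/
noncomputable def riceFunction {m : ℕ} (p e : (Fin m → ℝ) → (Fin m → ℝ) → ℝ≥0∞)
    (J : Fin m → Set ℝ) (v : Fin m → ℝ) : ℝ≥0∞ :=
  ∫⁻ t in Set.univ.pi J, e t v * p t v

/-- `J₁, …, Jₘ` are pairwise disjoint intervals (of any kind) contained in `I`. -/
def AreDisjointIntervals {m : ℕ} (I : Set ℝ) (J : Fin m → Set ℝ) : Prop :=
  (∀ i, (J i).OrdConnected) ∧ (∀ i, J i ⊆ I) ∧ Pairwise fun i j => Disjoint (J i) (J j)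

/-- The `[0, ∞]`-valued function `X` is a random variable (up to a null set) with finite
expectation `x`. -/
def HasFiniteExpectation {Ω : Type*} [MeasurableSpace Ω] (P : Measure Ω) (X : Ω → ℝ≥0∞)
    (x : ℝ≥0∞) : Prop :=
  AEMeasurable X P ∧ ∫⁻ ω, X ω ∂P = x ∧ x < ∞

end Rice

/-! The engine is Kac's counting formula. Let `f` be a C¹ path with finitely many critical points,
for which `u` is not a critical value and is not taken on the frontier of `J`. Between critical
points `f` is injective, so a change of variables turns `∫_J 1{|f - u| < δ} |f'|` into a sum, over
the gaps between critical points, of the lengths of the parts of `(u - δ, u + δ)` covered by `f`.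
For small `δ` this is exactly `2δ` times the number of crossings in `J`
(`eventually_kacIntegral_eq`); for every `δ` it is at most `2δ` times the number of critical points
plus one (`kacIntegral_le`).

Bulinskaya's lemma (`ae_pathDeriv_ne_zero`), drawn from A2, makes almost every path regular at `u`.
By Tonelli and conditioning on `(Y(t₁), …, Y(tₘ))`, the expected product of Kac integrals is the
integral of the Rice function over a sup-norm ball of radius `δ` about `(u, …, u)`
(`lintegral_prod_kacIntegral`). After division by `(2δ)^m`, continuity gives the limit of the right
side, and A3 dominates the left side. This is (i).

For (ii), the falling factorial counts `m`-tuples of distinct crossings. These are exhausted by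
tuples whose entries lie in distinct dyadic cells, and at each dyadic level (i) applies cell by
cell. Monotone convergence concludes, since the tuples with a repeated entry are Lebesgue-null. -/

namespace Rice

/-! ### Kac's counting formula for one path -/

/-- The set of points outside `S` with exactly `k` elements of `S` to their left. -/
def gap (S : Finset ℝ) (k : ℕ) : Set ℝ := {t | t ∉ S ∧ (S.filter (· < t)).card = k}

theorem ordConnected_gap (S : Finset ℝ) (k : ℕ) : (gap S k).OrdConnected := by
  refine ⟨fun x hx z hz y hy => ?_⟩
  have hxy : S.filter (· < x) ⊆ S.filter (· < y) :=
    Finset.monotone_filter_right _ fun s _ hs => hs.trans_le hy.1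
  have hyz : S.filter (· < y) ⊆ S.filter (· < z) :=
    Finset.monotone_filter_right _ fun s _ hs => hs.trans_le hy.2
  have h1 := Finset.card_le_card hxy
  have h2 := Finset.card_le_card hyz
  rw [hx.2] at h1
  rw [hz.2] at h2
  refine ⟨fun hyS => ?_, by omega⟩
  have hlt : y < z := lt_of_le_of_ne hy.2 (fun h => hz.1 (h ▸ hyS))
  have : S.filter (· < y) ⊂ S.filter (· < z) := by
    refine Finset.ssubset_iff_subset_ne.2 ⟨hyz, fun h => ?_⟩
    have : y ∈ S.filter (· < y) := h ▸ Finset.mem_filter.2 ⟨hyS, hlt⟩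
    exact lt_irrefl _ (Finset.mem_filter.1 this).2
  have h3 := Finset.card_lt_card this
  rw [hz.2] at h3
  omega

theorem isOpen_gap (S : Finset ℝ) (k : ℕ) : IsOpen (gap S k) := by
  rw [isOpen_iff_mem_nhds]
  intro t ht
  have : ∀ᶠ x in 𝓝 t, ∀ s ∈ S, x ≠ s ∧ (s < x ↔ s < t) := by
    rw [Filter.eventually_all_finset]
    intro s hs
    have hst : s ≠ t := fun h => ht.1 (h ▸ hs)
    rcases lt_or_gt_of_ne hst with h | h
    · filter_upwards [lt_mem_nhds h] with x hx using ⟨hx.ne', by simp [h, hx]⟩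
    · filter_upwards [gt_mem_nhds h] with x hx using ⟨hx.ne, iff_of_false (lt_asymm hx) (lt_asymm h)⟩
  filter_upwards [this] with x hx
  refine ⟨fun hxS => (hx x hxS).1 rfl, ?_⟩
  rw [← ht.2]
  congr 1
  exact Finset.filter_congr fun s hs => (hx s hs).2

theorem disjoint_gap (S : Finset ℝ) {j k : ℕ} (h : j ≠ k) : Disjoint (gap S j) (gap S k) :=
  Set.disjoint_left.2 fun _ hj hk => h (hj.2.symm.trans hk.2)

theorem biUnion_gap (S : Finset ℝ) :
    ⋃ k ∈ Finset.range (S.card + 1), gap S k = (S : Set ℝ)ᶜ := by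
  ext t
  simp only [mem_iUnion, Finset.mem_range, exists_prop, mem_compl_iff, Finset.mem_coe]
  refine ⟨fun ⟨k, _, h⟩ => h.1, fun h => ⟨_, ?_, h, rfl⟩⟩
  exact Nat.lt_succ_of_le (Finset.card_filter_le _ _)

theorem closure_gap_subset (S : Finset ℝ) (k : ℕ) : closure (gap S k) ⊆ gap S k ∪ S := by
  intro t ht
  by_cases hS : t ∈ S
  · exact Or.inr hS
  left
  have hj : t ∈ gap S (S.filter (· < t)).card := ⟨hS, rfl⟩
  obtain ⟨x, hx, hxk⟩ := mem_closure_iff.1 ht _ (isOpen_gap S _) hj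
  have := hx.2.symm.trans hxk.2
  rwa [this] at hj

variable {f : ℝ → ℝ} {a b u δ : ℝ} {S : Finset ℝ} {J : Set ℝ}

/-- Rolle: two equal values would force a critical point, hence a point of `S`, strictly between two
points of one gap. -/
theorem injOn_gap (hf : ContDiffOn ℝ 1 f (Icc a b))
    (hS : ∀ t ∈ Icc a b, derivWithin f (Icc a b) t = 0 → t ∈ S) (k : ℕ) :
    InjOn f (Icc a b ∩ gap S k) := by
  have key : ∀ x ∈ Icc a b ∩ gap S k, ∀ y ∈ Icc a b ∩ gap S k, x < y → f x ≠ f y := by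
    intro x hx y hy hxy heq
    have hsub : Icc x y ⊆ Icc a b := Icc_subset_Icc hx.1.1 hy.1.2
    obtain ⟨c, hc, hc0⟩ := exists_deriv_eq_zero hxy (hf.continuousOn.mono hsub) heq
    have hcI : c ∈ Icc a b := hsub (Ioo_subset_Icc_self hc)
    have hn : Icc a b ∈ 𝓝 c :=
      Icc_mem_nhds (hx.1.1.trans_lt hc.1) (hc.2.trans_le hy.1.2)
    have : c ∈ S := hS c hcI (by rw [derivWithin_of_mem_nhds hn, hc0])
    exact ((ordConnected_gap S k).out hx.2 hy.2 (Ioo_subset_Icc_self hc)).1 this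
  intro x hx y hy h
  by_contra hne
  rcases lt_or_gt_of_ne hne with hlt | hlt
  · exact key x hx y hy hlt h
  · exact key y hy x hx hlt h.symm

/-- The (unnormalized) Kac integral over `J` of a path `f` with derivative `g`. -/
noncomputable def kacIntegral (f g : ℝ → ℝ) (u δ : ℝ) (J : Set ℝ) : ℝ≥0∞ :=
  ∫⁻ t in J, (Metric.ball u δ).indicator 1 (f t) * ‖g t‖ₑ

/-- Change of variables on each gap, where `f` is injective; discarding the finite set `S` costs
nothing. -/
theorem kacIntegral_eq_sum (hf : ContDiffOn ℝ 1 f (Icc a b))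
    (hS : ∀ t ∈ Icc a b, derivWithin f (Icc a b) t = 0 → t ∈ S)
    (hJ : MeasurableSet J) (hJI : J ⊆ Icc a b) :
    kacIntegral f (derivWithin f (Icc a b)) u δ J =
      ∑ k ∈ Finset.range (S.card + 1), volume (Metric.ball u δ ∩ f '' (J ∩ gap S k)) := by
  have hae : (J : Set ℝ) =ᵐ[volume] ⋃ k ∈ Finset.range (S.card + 1), J ∩ gap S k := by
    rw [← inter_iUnion₂, biUnion_gap]
    exact (inter_ae_eq_left_of_ae_eq_univ
      (by rw [ae_eq_univ, compl_compl]; exact S.finite_toSet.measure_zero _)).symm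
  have hm : ∀ k, MeasurableSet (J ∩ gap S k) := fun k => hJ.inter (isOpen_gap S k).measurableSet
  rw [kacIntegral, setLIntegral_congr hae, lintegral_biUnion_finset]
  · refine Finset.sum_congr rfl fun k _ => ?_
    have hsub : J ∩ gap S k ⊆ Icc a b ∩ gap S k := inter_subset_inter_left _ hJI
    have h := lintegral_image_eq_lintegral_abs_deriv_mul (hm k)
      (f' := derivWithin f (Icc a b)) (f := f)
      (fun x hx => (((hf.differentiableOn one_ne_zero) x (hJI hx.1)).hasDerivWithinAt).mono
        (inter_subset_left.trans hJI)) ((injOn_gap hf hS k).mono hsub)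
      ((Metric.ball u δ).indicator 1)
    rw [lintegral_indicator_one Metric.isOpen_ball.measurableSet,
      Measure.restrict_apply Metric.isOpen_ball.measurableSet] at h
    rw [h]
    refine lintegral_congr fun t => ?_
    rw [mul_comm, Real.enorm_eq_ofReal_abs]
  · intro i _ j _ hij
    exact (disjoint_gap S hij).mono inter_subset_right inter_subset_right
  · exact fun k _ => hm k

/-- `c` critical points leave `c + 1` gaps, each covering the ball at most once. Uniformity in `δ`
is what later permits dominated convergence. -/
theorem kacIntegral_le (hf : ContDiffOn ℝ 1 f (Icc a b))
    (hfin : levelCount (derivWithin f (Icc a b)) 0 (Icc a b) < ∞)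
    (hJ : MeasurableSet J) (hJI : J ⊆ Icc a b) :
    kacIntegral f (derivWithin f (Icc a b)) u δ J ≤
      (levelCount (derivWithin f (Icc a b)) 0 (Icc a b) + 1) * volume (Metric.ball u δ) := by
  have hF : {t ∈ Icc a b | derivWithin f (Icc a b) t = 0}.Finite := by
    rw [← encard_lt_top_iff]
    simpa [levelCount] using hfin
  have hc : levelCount (derivWithin f (Icc a b)) 0 (Icc a b) = (hF.toFinset.card : ℝ≥0∞) := by
    rw [levelCount, hF.encard_eq_coe_toFinset_card]
    simp
  rw [kacIntegral_eq_sum (S := hF.toFinset) hf (fun t ht h => hF.mem_toFinset.2 ⟨ht, h⟩) hJ hJI, hc]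
  refine (Finset.sum_le_card_nsmul _ _ _ fun k _ => measure_mono inter_subset_left).trans ?_
  simp

theorem frontier_subset_of_ordConnected (hJ : J.OrdConnected) (hJI : J ⊆ Icc a b) :
    frontier J ⊆ {sInf J, sSup J} := by
  rcases J.eq_empty_or_nonempty with rfl | hne
  · simp
  have hb : BddBelow J := bddBelow_Icc.mono hJI
  have ha : BddAbove J := bddAbove_Icc.mono hJI
  have h1 : Ioo (sInf J) (sSup J) ⊆ interior J := isOpen_Ioo.subset_interior_iff.2
    (IsConnected.Ioo_csInf_csSup_subset ⟨hne, hJ.isPreconnected⟩ hb ha)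
  have h2 : closure J ⊆ Icc (sInf J) (sSup J) :=
    closure_minimal (subset_Icc_csInf_csSup hb ha) isClosed_Icc
  rintro t ⟨ht1, ht2⟩
  have h3 := h2 ht1
  by_contra hcon
  simp only [mem_insert_iff, mem_singleton_iff, not_or] at hcon
  exact ht2 (h1 ⟨lt_of_le_of_ne h3.1 (Ne.symm hcon.1), lt_of_le_of_ne h3.2 hcon.2⟩)

theorem image_mem_nhds_of_derivWithin_ne_zero (hf : ContDiffOn ℝ 1 f (Icc a b)) {t : ℝ}
    {s : Set ℝ} (hs : s ∈ 𝓝 t) (hsI : s ⊆ Icc a b)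
    (ht : derivWithin f (Icc a b) t ≠ 0) : f '' s ∈ 𝓝 (f t) := by
  have hn : Icc a b ∈ 𝓝 t := mem_of_superset hs hsI
  have h := (hf.contDiffAt hn).hasStrictDerivAt one_ne_zero
  rw [derivWithin_of_mem_nhds hn] at ht
  rw [← h.map_nhds_eq ht]
  exact image_mem_map hs

/-- A gap holds at most one crossing. If it holds one, the crossing is interior to `J`, and the
inverse function theorem makes the image cover a small ball. If it holds none, `u` stays away from
the compact image of the closure, because the closure adds only points of `S` and of the frontier of
`J`. -/
theorem eventually_kacIntegral_eq (hf : ContDiffOn ℝ 1 f (Icc a b))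
    (hfin : levelCount (derivWithin f (Icc a b)) 0 (Icc a b) < ∞)
    (hreg : ∀ t ∈ Icc a b, f t = u → derivWithin f (Icc a b) t ≠ 0)
    (hJ : J.OrdConnected) (hJI : J ⊆ Icc a b) (hfr : ∀ t ∈ frontier J, f t ≠ u) :
    ∀ᶠ δ in 𝓝[>] (0 : ℝ), kacIntegral f (derivWithin f (Icc a b)) u δ J =
      levelCount f u J * volume (Metric.ball u δ) := by
  have hF : {t ∈ Icc a b | derivWithin f (Icc a b) t = 0}.Finite := by
    rw [← encard_lt_top_iff]
    simpa [levelCount] using hfin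
  set S := hF.toFinset with hSdef
  have hS : ∀ t ∈ Icc a b, derivWithin f (Icc a b) t = 0 → t ∈ S :=
    fun t ht h => hF.mem_toFinset.2 ⟨ht, h⟩
  have hSu : ∀ t ∈ S, f t ≠ u := fun t ht h =>
    hreg t (hF.mem_toFinset.1 ht).1 h (hF.mem_toFinset.1 ht).2
  have hinj := injOn_gap hf hS
  have hsubs : ∀ k, {t ∈ J ∩ gap S k | f t = u}.Subsingleton := fun k x hx y hy =>
    hinj k ⟨hJI hx.1.1, hx.1.2⟩ ⟨hJI hy.1.1, hy.1.2⟩ (hx.2.trans hy.2.symm)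
  have hcount : levelCount f u J =
      ∑ k ∈ Finset.range (S.card + 1), levelCount f u (J ∩ gap S k) := by
    have hc : ∀ k, levelCount f u (J ∩ gap S k) = Measure.count {t ∈ J ∩ gap S k | f t = u} :=
      fun k => (Measure.count_apply (hsubs k).measurableSet).symm
    have hU : {t ∈ J | f t = u} =
        ⋃ k ∈ Finset.range (S.card + 1), {t ∈ J ∩ gap S k | f t = u} := by
      ext t
      simp only [mem_iUnion, exists_prop, mem_ofPred_eq, mem_inter_iff]
      constructor
      · rintro ⟨htJ, htu⟩
        have : t ∈ ⋃ k ∈ Finset.range (S.card + 1), gap S k := by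
          rw [biUnion_gap]
          exact fun h => hSu t h htu
        simp only [mem_iUnion, exists_prop] at this
        obtain ⟨k, hk, htk⟩ := this
        exact ⟨k, hk, ⟨htJ, htk⟩, htu⟩
      · rintro ⟨k, _, h⟩
        exact ⟨h.1.1, h.2⟩
    simp_rw [hc]
    rw [← measure_biUnion_finset, ← hU, levelCount, Measure.count_apply]
    · rw [hU]
      exact Finset.measurableSet_biUnion _ fun k _ => (hsubs k).measurableSet
    · intro i _ j _ hij
      exact (disjoint_gap S hij).mono (fun x hx => hx.1.2) (fun x hx => hx.1.2)
    · exact fun k _ => (hsubs k).measurableSet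
  have hk : ∀ k ∈ Finset.range (S.card + 1), ∀ᶠ δ in 𝓝[>] (0 : ℝ),
      volume (Metric.ball u δ ∩ f '' (J ∩ gap S k)) =
        levelCount f u (J ∩ gap S k) * volume (Metric.ball u δ) := by
    intro k _
    by_cases hex : ∃ t ∈ J ∩ gap S k, f t = u
    · obtain ⟨t, ht, htu⟩ := hex
      have h1 : levelCount f u (J ∩ gap S k) = 1 := by
        have : {x ∈ J ∩ gap S k | f x = u} = {t} :=
          (hsubs k).eq_singleton_of_mem ⟨ht, htu⟩
        rw [levelCount, this, encard_singleton]
        simp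
      have hJn : J ∈ 𝓝 t := by
        by_contra hcon
        exact hfr t ⟨subset_closure ht.1, fun h => hcon (mem_interior_iff_mem_nhds.1 h)⟩ htu
      have hn : f '' (J ∩ gap S k) ∈ 𝓝 (f t) :=
        image_mem_nhds_of_derivWithin_ne_zero hf
          (inter_mem hJn ((isOpen_gap S k).mem_nhds ht.2)) (inter_subset_left.trans hJI)
          (hreg t (hJI ht.1) htu)
      rw [htu] at hn
      obtain ⟨ε, hε, hball⟩ := Metric.mem_nhds_iff.1 hn
      filter_upwards [Ioo_mem_nhdsGT hε] with δ hδ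
      rw [h1, one_mul, inter_eq_left.2 ((Metric.ball_subset_ball hδ.2.le).trans hball)]
    · push Not at hex
      have h0 : levelCount f u (J ∩ gap S k) = 0 := by
        have : {x ∈ J ∩ gap S k | f x = u} = ∅ :=
          eq_empty_of_forall_notMem fun x hx => hex x hx.1 hx.2
        rw [levelCount, this]
        simp
      have hcl : ∀ t ∈ closure (J ∩ gap S k), f t ≠ u := by
        intro t ht
        have h1 : t ∈ closure J := closure_mono inter_subset_left ht
        rcases closure_gap_subset S k (closure_mono inter_subset_right ht) with h2 | h2
        · by_cases htJ : t ∈ J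
          · exact hex t ⟨htJ, h2⟩
          · exact hfr t ⟨h1, fun h => htJ (interior_subset h)⟩
        · exact hSu t h2
      have hclI : closure (J ∩ gap S k) ⊆ Icc a b :=
        closure_minimal (inter_subset_left.trans hJI) isClosed_Icc
      have hcomp : IsCompact (f '' closure (J ∩ gap S k)) :=
        (isCompact_Icc.of_isClosed_subset isClosed_closure hclI).image_of_continuousOn
          (hf.continuousOn.mono hclI)
      have hn : (f '' closure (J ∩ gap S k))ᶜ ∈ 𝓝 u := by
        refine hcomp.isClosed.isOpen_compl.mem_nhds ?_
        rintro ⟨t, ht, htu⟩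
        exact hcl t ht htu
      obtain ⟨ε, hε, hball⟩ := Metric.mem_nhds_iff.1 hn
      filter_upwards [Ioo_mem_nhdsGT hε] with δ hδ
      have : Metric.ball u δ ∩ f '' (J ∩ gap S k) = ∅ := by
        refine eq_empty_of_forall_notMem ?_
        rintro _ ⟨hx, t, ht, rfl⟩
        exact hball (Metric.ball_subset_ball hδ.2.le hx) ⟨t, subset_closure ht, rfl⟩
      rw [h0, this]
      simp
  filter_upwards [(Filter.eventually_all_finset _).2 hk] with δ hδ
  rw [kacIntegral_eq_sum hf hS hJ.measurableSet hJI, hcount, Finset.sum_mul]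
  exact Finset.sum_congr rfl hδ

/-- Compare the exact value and the upper bound of the Kac integral at a single small `δ`. -/
theorem levelCount_le (hf : ContDiffOn ℝ 1 f (Icc a b))
    (hfin : levelCount (derivWithin f (Icc a b)) 0 (Icc a b) < ∞)
    (hreg : ∀ t ∈ Icc a b, f t = u → derivWithin f (Icc a b) t ≠ 0)
    (hJ : J.OrdConnected) (hJI : J ⊆ Icc a b) (hfr : ∀ t ∈ frontier J, f t ≠ u) :
    levelCount f u J ≤ levelCount (derivWithin f (Icc a b)) 0 (Icc a b) + 1 := by
  obtain ⟨δ, h, hδ⟩ :=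
    ((eventually_kacIntegral_eq hf hfin hreg hJ hJI hfr).and self_mem_nhdsWithin).exists
  have h1 := kacIntegral_le (u := u) (δ := δ) hf hfin hJ.measurableSet hJI
  rw [h] at h1
  have hpos : volume (Metric.ball u δ) ≠ 0 := (Metric.measure_ball_pos _ _ hδ).ne'
  exact (ENNReal.mul_le_mul_iff_left hpos measure_ball_lt_top.ne).1 h1

end Rice

/-! ### Dyadic cells and measurability -/

namespace Rice

/-- The half-open dyadic interval `[k / 2 ^ N, (k + 1) / 2 ^ N)`. -/
def dyadicCell (N : ℕ) (k : ℤ) : Set ℝ := {t | ⌊2 ^ N * t⌋ = k}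

theorem dyadicCell_eq_Ico (N : ℕ) (k : ℤ) :
    dyadicCell N k = Ico (k / 2 ^ N : ℝ) ((k + 1) / 2 ^ N) := by
  ext t
  simp only [dyadicCell, mem_ofPred_eq, Int.floor_eq_iff, mem_Ico]
  rw [div_le_iff₀' (by positivity), lt_div_iff₀' (by positivity)]

theorem ordConnected_dyadicCell (N : ℕ) (k : ℤ) : (dyadicCell N k).OrdConnected := by
  rw [dyadicCell_eq_Ico]
  exact ordConnected_Ico

theorem disjoint_dyadicCell (N : ℕ) {j k : ℤ} (h : j ≠ k) :
    Disjoint (dyadicCell N j) (dyadicCell N k) :=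
  Set.disjoint_left.2 fun _ hj hk => h (hj.symm.trans hk)

theorem floor_dyadic_of_succ {N : ℕ} {s t : ℝ} (h : ⌊2 ^ (N + 1) * s⌋ = ⌊2 ^ (N + 1) * t⌋) :
    ⌊2 ^ N * s⌋ = ⌊2 ^ N * t⌋ := by
  have key : ∀ x : ℝ, ⌊2 ^ N * x⌋ = ⌊2 ^ (N + 1) * x⌋ / 2 := by
    intro x
    have h2 := Int.floor_div_natCast (2 ^ (N + 1) * x) 2
    simp only [Nat.cast_ofNat] at h2
    rw [← h2]
    congr 1
    ring
  rw [key, key, h]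

theorem eventually_floor_dyadic_ne {s t : ℝ} (h : s ≠ t) :
    ∀ᶠ N : ℕ in atTop, ⌊2 ^ N * s⌋ ≠ ⌊2 ^ N * t⌋ := by
  have hpos : 0 < |s - t| := abs_pos.2 (sub_ne_zero.2 h)
  have h1 : Tendsto (fun N : ℕ => (2 : ℝ) ^ N) atTop atTop :=
    tendsto_pow_atTop_atTop_of_one_lt one_lt_two
  filter_upwards [h1.eventually_gt_atTop (1 / |s - t|)] with N hN heq
  have h2 := Int.abs_sub_lt_one_of_floor_eq_floor heq
  rw [← mul_sub, abs_mul, abs_of_pos (by positivity : (0 : ℝ) < 2 ^ N)] at h2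
  rw [div_lt_iff₀ hpos] at hN
  linarith

theorem eventually_injective_floor_dyadic {ι : Type*} [Finite ι] {t : ι → ℝ}
    (ht : Function.Injective t) :
    ∀ᶠ N : ℕ in atTop, Function.Injective fun i => ⌊2 ^ N * t i⌋ := by
  have : ∀ᶠ N : ℕ in atTop, ∀ i j, i ≠ j → ⌊2 ^ N * t i⌋ ≠ ⌊2 ^ N * t j⌋ := by
    rw [eventually_all]
    intro i
    rw [eventually_all]
    intro j
    by_cases hij : i = j
    · simp [hij]
    · filter_upwards [eventually_floor_dyadic_ne (ht.ne hij)] with N hN _ using hN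
  filter_upwards [this] with N hN i j hij
  by_contra hne
  exact hN i j hne hij

variable {Ω : Type*} [MeasurableSpace Ω] {X Y : ℝ → Ω → ℝ} {a b u : ℝ}

/-- By compactness, a zero exists as soon as `|X|` takes arbitrarily small values, and by continuity
these can be sought on a countable dense set. -/
theorem measurableSet_exists_zero {K : Set ℝ} (hK : IsCompact K)
    (hm : ∀ t ∈ K, Measurable (X t)) (hc : ∀ ω, ContinuousOn (fun t => X t ω) K) :
    MeasurableSet {ω | ∃ t ∈ K, X t ω = 0} := by
  rcases K.eq_empty_or_nonempty with rfl | hne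
  · simp
  have : Nonempty K := hne.to_subtype
  have heq : {ω | ∃ t ∈ K, X t ω = 0} =
      ⋂ n : ℕ, ⋃ i : ℕ, {ω | |X (TopologicalSpace.denseSeq K i) ω| < 1 / (n + 1)} := by
    ext ω
    simp only [mem_ofPred_eq, mem_iInter, mem_iUnion]
    constructor
    · rintro ⟨t, ht, h0⟩ n
      have hcont : Continuous fun s : K => |X s ω| :=
        (continuousOn_iff_continuous_domRestrict.1 (hc ω)).abs
      have hopen : IsOpen {s : K | |X s ω| < 1 / ((n : ℝ) + 1)} := isOpen_Iio.preimage hcont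
      exact (TopologicalSpace.denseRange_denseSeq K).exists_mem_open hopen
        ⟨⟨t, ht⟩, by simp only [mem_ofPred_eq, h0, abs_zero]; positivity⟩
    · intro h
      obtain ⟨t, ht, hmin⟩ := hK.exists_isMinOn hne (hc ω).abs
      refine ⟨t, ht, ?_⟩
      by_contra hcon
      obtain ⟨n, hn⟩ := exists_nat_one_div_lt (abs_pos.2 hcon)
      obtain ⟨i, hi⟩ := h n
      have := hmin (TopologicalSpace.denseSeq K i).2
      simp only [mem_ofPred_eq] at this
      linarith
  rw [heq]
  refine MeasurableSet.iInter fun n => MeasurableSet.iUnion fun i => ?_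
  exact measurableSet_lt (hm _ (TopologicalSpace.denseSeq K i).2).abs measurable_const

theorem measurableSet_exists_zero_dyadicCell (hm : ∀ t ∈ Icc a b, Measurable (X t))
    (hc : ∀ ω, ContinuousOn (fun t => X t ω) (Icc a b)) (N : ℕ) (k : ℤ) :
    MeasurableSet {ω | ∃ t ∈ Icc a b ∩ dyadicCell N k, X t ω = 0} := by
  have heq : {ω | ∃ t ∈ Icc a b ∩ dyadicCell N k, X t ω = 0} =
      ⋃ q : {q : ℚ // (q : ℝ) < (k + 1) / 2 ^ N},
        {ω | ∃ t ∈ Icc a b ∩ Icc (k / 2 ^ N : ℝ) q, X t ω = 0} := by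
    ext ω
    simp only [dyadicCell_eq_Ico, mem_iUnion, mem_ofPred_eq, mem_inter_iff, mem_Ico]
    constructor
    · rintro ⟨t, ⟨htI, ht1, ht2⟩, h0⟩
      obtain ⟨q, hq1, hq2⟩ := exists_rat_btwn ht2
      exact ⟨⟨q, hq2⟩, t, ⟨htI, ht1, hq1.le⟩, h0⟩
    · rintro ⟨q, t, ⟨htI, ht1, ht2⟩, h0⟩
      exact ⟨t, ⟨htI, ht1, lt_of_le_of_lt ht2 q.2⟩, h0⟩
  rw [heq]
  refine MeasurableSet.iUnion fun q => ?_
  exact measurableSet_exists_zero (isCompact_Icc.inter_right isClosed_Icc)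
    (fun t ht => hm t ht.1) (fun ω => (hc ω).mono inter_subset_left)

instance countable_fin_embedding_int (n : ℕ) : Countable (Fin n ↪ ℤ) :=
  DFunLike.coe_injective.countable

/-- Finitely many distinct points are separated by a fine enough dyadic grid. Having at least `n`
points thus becomes a countable combination of events "some point lies in this cell". -/
theorem natCast_le_encard_iff {Z : Set ℝ} {n : ℕ} :
    (n : ℕ∞) ≤ Z.encard ↔
      ∃ N : ℕ, ∃ σ : Fin n ↪ ℤ, ∀ i, ∃ t ∈ Z, t ∈ dyadicCell N (σ i) := by
  constructor
  · intro h
    obtain ⟨T, hTZ, hT⟩ := exists_subset_encard_eq h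
    have hTf : T.Finite := finite_of_encard_eq_coe hT
    have : Nonempty (Fin n ≃ T) := by
      have := hTf.fintype
      refine ⟨(Fintype.equivFinOfCardEq ?_).symm⟩
      rw [← Nat.card_eq_fintype_card, Nat.card_coe_set_eq, ncard_def, hT, ENat.toNat_natCast]
    obtain ⟨e⟩ := this
    obtain ⟨N, hN⟩ := (eventually_injective_floor_dyadic
      (Subtype.val_injective.comp e.injective)).exists
    exact ⟨N, ⟨_, hN⟩, fun i => ⟨e i, hTZ (e i).2, rfl⟩⟩
  · rintro ⟨N, σ, h⟩
    choose t htZ ht using h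
    have hinj : Function.Injective t := by
      intro i j hij
      have h1 := ht i
      rw [hij] at h1
      exact σ.injective (h1.symm.trans (ht j))
    calc (n : ℕ∞) ≤ (range t).encard := by simpa using hinj.encard_range
      _ ≤ Z.encard := encard_le_encard (range_subset_iff.2 htZ)

theorem measurable_levelCount_zero (hm : ∀ t ∈ Icc a b, Measurable (X t))
    (hc : ∀ ω, ContinuousOn (fun t => X t ω) (Icc a b)) :
    Measurable fun ω => levelCount (fun t => X t ω) 0 (Icc a b) := by
  refine measurable_of_Ioi fun c => ?_
  have heq : (fun ω => levelCount (fun t => X t ω) 0 (Icc a b)) ⁻¹' Ioi c =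
      ⋃ n : {n : ℕ // c < n}, ⋃ N : ℕ, ⋃ σ : Fin n ↪ ℤ, ⋂ i : Fin n,
        {ω | ∃ t ∈ Icc a b ∩ dyadicCell N (σ i), X t ω = 0} := by
    ext ω
    have h1 : c < levelCount (fun t => X t ω) 0 (Icc a b) ↔
        ∃ n : {n : ℕ // c < n}, ((n : ℕ) : ℕ∞) ≤ ({t ∈ Icc a b | X t ω = 0}).encard := by
      rw [levelCount]
      generalize ({t ∈ Icc a b | X t ω = 0} : Set ℝ).encard = z
      constructor
      · intro h
        induction z using ENat.recTopCoe with
        | top =>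
          obtain ⟨n, hn⟩ := ENNReal.exists_nat_gt (h.trans_le le_top).ne
          exact ⟨⟨n, hn⟩, le_top⟩
        | coe n => exact ⟨⟨n, by simpa using h⟩, le_rfl⟩
      · rintro ⟨⟨n, hn⟩, h⟩
        refine hn.trans_le ?_
        have := ENat.toENNReal_le.2 h
        simpa using this
    rw [mem_preimage, mem_Ioi, h1]
    simp only [natCast_le_encard_iff, mem_iUnion, mem_iInter, mem_ofPred_eq, mem_inter_iff]
    refine exists_congr fun n => exists_congr fun N => exists_congr fun σ => forall_congr' fun i =>
      exists_congr fun t => ?_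
    tauto
  rw [heq]
  refine MeasurableSet.iUnion fun n => MeasurableSet.iUnion fun N => MeasurableSet.iUnion fun σ =>
    MeasurableSet.iInter fun i => measurableSet_exists_zero_dyadicCell hm hc N (σ i)

/-- Clamping the time to `[a, b]` gives paths continuous on all of `ℝ`, hence joint measurability.
-/
theorem measurable_uncurry_projIcc (hab : a ≤ b) (hm : ∀ t ∈ Icc a b, Measurable (X t))
    (hc : ∀ ω, ContinuousOn (fun t => X t ω) (Icc a b)) :
    Measurable (Function.uncurry fun (t : ℝ) ω => X (projIcc a b hab t) ω) := by
  refine measurable_uncurry_of_continuous_of_measurable (fun ω => ?_) fun t => hm _ (projIcc a b hab t).2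
  exact (continuousOn_iff_continuous_domRestrict.1 (hc ω)).comp continuous_projIcc

theorem continuousOn_pathDeriv {Ω : Type*} {Y : ℝ → Ω → ℝ}
    (hA1 : ∀ ω, ContDiffOn ℝ 1 (fun t => Y t ω) (Icc a b)) (ω : Ω) :
    ContinuousOn (pathDeriv Y (Icc a b) ω) (Icc a b) := by
  rcases lt_or_ge a b with hlt | hge
  · exact (hA1 ω).continuousOn_derivWithin (uniqueDiffOn_Icc hlt) le_rfl
  · exact (subsingleton_Icc_of_ge hge).continuousOn _

theorem measurable_pathDeriv (hY : ∀ t ∈ Icc a b, Measurable (Y t))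
    (hA1 : ∀ ω, ContDiffOn ℝ 1 (fun t => Y t ω) (Icc a b)) {t : ℝ} (ht : t ∈ Icc a b) :
    Measurable fun ω => pathDeriv Y (Icc a b) ω t := by
  rcases lt_or_ge a b with hlt | hge
  · have hacc : t ∈ closure (Icc a b \ {t}) := by
      rw [mem_closure_iff_nhdsWithin_neBot, ← accPt_principal_iff_nhdsWithin]
      exact (uniqueDiffOn_Icc hlt t ht).accPt
    obtain ⟨x, hx, hxt⟩ := mem_closure_iff_seq_limit.1 hacc
    refine measurable_of_tendsto_metrizable
      (f := fun n ω => slope (fun s => Y s ω) t (x n)) (fun n => ?_) ?_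
    · simp only [slope_def_field]
      exact ((hY _ (hx n).1).sub (hY t ht)).div_const _
    · rw [tendsto_pi_nhds]
      intro ω
      have h := hasDerivWithinAt_iff_tendsto_slope.1
        ((((hA1 ω).differentiableOn one_ne_zero) t ht).hasDerivWithinAt)
      exact h.comp (tendsto_nhdsWithin_iff.2 ⟨hxt, Eventually.of_forall hx⟩)
  -- Here `a = b`: the point is isolated and the derivative takes its default value `0`.
  · have : ∀ ω, pathDeriv Y (Icc a b) ω t = 0 := fun ω =>
      derivWithin_zero_of_not_accPt fun h => by
        obtain ⟨s, hs, hst⟩ := accPt_iff_nhds.1 h univ univ_mem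
        exact hst (subsingleton_Icc_of_ge hge hs.2 ht)
    simp only [this]
    exact measurable_const

end Rice

/-! ### Bulinskaya's lemma -/

namespace Rice

theorem measure_preimage_eq_zero_of_isDensity {Ω : Type*} [MeasurableSpace Ω] {P : Measure Ω}
    {V : Ω → ℝ} {q : ℝ → ℝ≥0∞} (hV : Measurable V) (hq : IsDensity P V q) (u : ℝ) :
    P {ω | V ω = u} = 0 := by
  have h : P.map V {u} = 0 := by
    rw [hq.2]
    exact withDensity_absolutelyContinuous _ _ (measure_singleton u)
  rwa [Measure.map_apply hV (measurableSet_singleton u)] at h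

theorem measure_abs_sub_le_of_isDensity {Ω : Type*} [MeasurableSpace Ω] {P : Measure Ω}
    {V : Ω → ℝ} {q : ℝ → ℝ≥0∞} (hV : Measurable V) (hq : IsDensity P V q) {u r : ℝ} {C : ℝ≥0}
    (hC : ∀ y ∈ Metric.closedBall u r, q y ≤ C) :
    P {ω | |V ω - u| ≤ r} ≤ C * ENNReal.ofReal (2 * r) := by
  have h : P {ω | |V ω - u| ≤ r} = P.map V (Metric.closedBall u r) := by
    rw [Measure.map_apply hV Metric.isClosed_closedBall.measurableSet]
    rfl
  rw [h, hq.2, withDensity_apply _ Metric.isClosed_closedBall.measurableSet]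
  refine (setLIntegral_mono measurable_const hC).trans ?_
  rw [setLIntegral_const, Real.volume_closedBall]

section Bulinskaya

variable {Ω : Type*} [MeasurableSpace Ω] {P : Measure Ω} {Y : ℝ → Ω → ℝ} {a b u : ℝ}

theorem exists_grid_point (hab : a ≤ b) {t : ℝ} (ht : t ∈ Icc a b) (n : ℕ) :
    ∃ k ∈ Finset.range (n + 2), a + (b - a) / (n + 1) * k ∈ Icc a b ∧
      |a + (b - a) / (n + 1) * k - t| ≤ (b - a) / (n + 1) := by
  have hn : (0 : ℝ) < n + 1 := by positivity
  -- Position of `t` in units of the mesh; the grid point is its integer part. If `a = b` the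
  -- quotient is `0` and the grid collapses to `a`.
  set x : ℝ := (t - a) / (b - a) * (n + 1) with hx
  have hba : 0 ≤ b - a := sub_nonneg.2 hab
  have hta : 0 ≤ t - a := sub_nonneg.2 ht.1
  have hx0 : 0 ≤ x := by positivity
  have hx1 : x ≤ n + 1 := by
    have : (t - a) / (b - a) ≤ 1 := div_le_one_of_le₀ (by linarith [ht.2]) hba
    nlinarith
  have hxt : t = a + (b - a) / (n + 1) * x := by
    rcases hba.eq_or_lt with h | h
    · have : t = a := le_antisymm (by linarith [ht.2]) ht.1
      rw [← h, this]
      simp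
    · rw [hx]
      field_simp
      ring
  have hh : 0 ≤ (b - a) / (n + 1) := by positivity
  have hk1 : (⌊x⌋₊ : ℝ) ≤ x := Nat.floor_le hx0
  have hk2 : x < ⌊x⌋₊ + 1 := Nat.lt_floor_add_one x
  have hkx : (b - a) / (n + 1) * ⌊x⌋₊ ≤ (b - a) / (n + 1) * x := by gcongr
  refine ⟨⌊x⌋₊, ?_, ⟨?_, ?_⟩, ?_⟩
  · have : (⌊x⌋₊ : ℝ) ≤ (n + 1 : ℕ) := by push_cast; linarith
    have := Nat.cast_le.1 this
    simp only [Finset.mem_range]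
    omega
  · have : 0 ≤ (b - a) / (n + 1) * (⌊x⌋₊ : ℝ) := by positivity
    linarith
  · linarith [ht.2]
  · rw [abs_sub_comm, abs_of_nonneg (by linarith), hxt]
    have : (b - a) / (n + 1) * x ≤ (b - a) / (n + 1) * (⌊x⌋₊ + 1) := by gcongr
    linarith

/-- **Bulinskaya's lemma**: almost surely, the level `u` is not a critical value. -/
theorem ae_pathDeriv_ne_zero (hab : a ≤ b) (hY : ∀ t ∈ Icc a b, Measurable (Y t))
    (hA1 : ∀ ω, ContDiffOn ℝ 1 (fun t => Y t ω) (Icc a b))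
    (hA2 : HasBoundedDensitiesNear P Y (Icc a b) u) :
    ∀ᵐ ω ∂P, ∀ t ∈ Icc a b, Y t ω = u → pathDeriv Y (Icc a b) ω t ≠ 0 := by
  obtain ⟨C, U, hU, hq⟩ := hA2
  have hba : 0 ≤ b - a := sub_nonneg.2 hab
  set D : Set Ω := {ω | ∃ t ∈ Icc a b, Y t ω = u ∧ pathDeriv Y (Icc a b) ω t = 0} with hD
  suffices hD0 : P D = 0 by
    filter_upwards [measure_eq_zero_iff_ae_notMem.1 hD0] with ω hω t ht h1 h2
    exact hω ⟨t, ht, h1, h2⟩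
  have hstep : Tendsto (fun n : ℕ => (b - a) / ((n : ℝ) + 1)) atTop (𝓝 0) := by
    simpa [div_eq_mul_inv] using (tendsto_one_div_add_atTop_nhds_zero_nat (𝕜 := ℝ)).const_mul (b - a)
  -- Near a tangency at level `u`, the path at a grid point within one mesh `h = (b - a)/(n + 1)` is
  -- `η h`-close to `u`. Each of the at most `n + 2` grid points has this with probability at most
  -- `2Cηh`, and `(n + 2)/(n + 1) ≤ 2` yields the constant `4`.
  have key : ∀ η : ℝ, 0 < η → P D ≤ C * ENNReal.ofReal (4 * η * (b - a)) := by
    intro η hη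
    set E : ℕ → Set Ω := fun n => ⋃ k ∈ (Finset.range (n + 2)).filter
      (fun k : ℕ => a + (b - a) / (n + 1) * k ∈ Icc a b),
      {ω | |Y (a + (b - a) / (n + 1) * k) ω - u| ≤ η * ((b - a) / (n + 1))} with hE
    have hDE : ∀ ω ∈ D, ∀ᶠ n in atTop, ω ∈ E n := by
      rintro ω ⟨t, ht, htu, ht0⟩
      have hd : HasDerivWithinAt (fun s => Y s ω) 0 (Icc a b) t := by
        have := (((hA1 ω).differentiableOn one_ne_zero) t ht).hasDerivWithinAt
        rwa [show derivWithin (fun s => Y s ω) (Icc a b) t = 0 from ht0] at this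
      have h1 := (hasDerivWithinAt_iff_isLittleO.1 hd).def hη
      simp only [smul_zero, sub_zero, Real.norm_eq_abs] at h1
      obtain ⟨r, hr, hball⟩ := Metric.mem_nhdsWithin_iff.1 h1
      filter_upwards [hstep.eventually_lt_const hr] with n hn
      obtain ⟨k, hk, hkI, hkt⟩ := exists_grid_point hab ht n
      rw [hE]
      simp only [mem_iUnion, exists_prop, Finset.mem_filter]
      refine ⟨k, ⟨hk, hkI⟩, ?_⟩
      have h2 := hball ⟨show _ ∈ Metric.ball t r from
        (by rw [Metric.mem_ball, Real.dist_eq]; exact hkt.trans_lt hn), hkI⟩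
      simp only [mem_ofPred_eq, htu] at h2 ⊢
      exact h2.trans (by gcongr)
    have hPE : ∀ᶠ n in atTop, P (E n) ≤ C * ENNReal.ofReal (4 * η * (b - a)) := by
      obtain ⟨r, hr, hball⟩ := Metric.mem_nhds_iff.1 hU
      have hstep' := hstep.const_mul η
      rw [mul_zero] at hstep'
      filter_upwards [hstep'.eventually_lt_const hr] with n hn
      refine (measure_biUnion_finset_le _ _).trans ?_
      have hb : ∀ k ∈ (Finset.range (n + 2)).filter
          (fun k : ℕ => a + (b - a) / (n + 1) * k ∈ Icc a b),
          P {ω | |Y (a + (b - a) / (n + 1) * k) ω - u| ≤ η * ((b - a) / (n + 1))} ≤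
            C * ENNReal.ofReal (2 * (η * ((b - a) / (n + 1)))) := by
        intro k hk
        have hkI := (Finset.mem_filter.1 hk).2
        obtain ⟨q, hqd, hqC⟩ := hq _ hkI
        exact measure_abs_sub_le_of_isDensity (hY _ hkI) hqd
          fun y hy => hqC y (hball (Metric.closedBall_subset_ball hn hy))
      refine (Finset.sum_le_card_nsmul _ _ _ hb).trans ?_
      have hcard : ((Finset.range (n + 2)).filter
          (fun k : ℕ => a + (b - a) / (n + 1) * k ∈ Icc a b)).card ≤ n + 2 :=
        (Finset.card_filter_le _ _).trans (Finset.card_range _).le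
      rw [nsmul_eq_mul, mul_left_comm]
      gcongr
      calc _ ≤ ((n + 2 : ℕ) : ℝ≥0∞) * ENNReal.ofReal (2 * (η * ((b - a) / (n + 1)))) := by
            gcongr
        _ = ENNReal.ofReal ((n + 2 : ℕ) * (2 * (η * ((b - a) / (n + 1))))) := by
            rw [ENNReal.ofReal_mul (p := ((n + 2 : ℕ) : ℝ)) (by positivity), ENNReal.ofReal_natCast]
        _ ≤ ENNReal.ofReal (4 * η * (b - a)) := by
            apply ENNReal.ofReal_le_ofReal
            push_cast
            have : ((n : ℝ) + 2) * (2 * (η * ((b - a) / (n + 1)))) =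
                ((n + 2) / (n + 1)) * (2 * η * (b - a)) := by field_simp
            rw [this]
            have h2 : ((n : ℝ) + 2) / (n + 1) ≤ 2 := by
              rw [div_le_iff₀ (by positivity)]
              linarith [(Nat.cast_nonneg n : (0 : ℝ) ≤ n)]
            calc _ ≤ 2 * (2 * η * (b - a)) := by gcongr
              _ = _ := by ring
    -- `D` is not known to be measurable; continuity from below holds for increasing unions of
    -- arbitrary sets.
    have hmono : Monotone fun N : ℕ => {ω | ω ∈ D ∧ ∀ n ≥ N, ω ∈ E n} :=
      fun N M hNM ω hω => ⟨hω.1, fun n hn => hω.2 n (hNM.trans hn)⟩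
    have hDU : D ⊆ ⋃ N : ℕ, {ω | ω ∈ D ∧ ∀ n ≥ N, ω ∈ E n} := by
      intro ω hω
      obtain ⟨N, hN⟩ := eventually_atTop.1 (hDE ω hω)
      exact mem_iUnion.2 ⟨N, hω, hN⟩
    refine (measure_mono hDU).trans ?_
    rw [hmono.measure_iUnion]
    refine iSup_le fun N => ?_
    obtain ⟨n, hn, hnN⟩ := (hPE.and (eventually_ge_atTop N)).exists
    exact (measure_mono fun ω hω => hω.2 n hnN).trans hn
  have hlim : Tendsto (fun η : ℝ => (C : ℝ≥0∞) * ENNReal.ofReal (4 * η * (b - a)))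
      (𝓝[>] 0) (𝓝 0) := by
    have h1 : Tendsto (fun η : ℝ => ENNReal.ofReal (4 * η * (b - a))) (𝓝 0)
        (𝓝 (ENNReal.ofReal (4 * 0 * (b - a)))) :=
      (ENNReal.continuous_ofReal.comp (by fun_prop)).tendsto 0
    have h2 := ENNReal.Tendsto.const_mul (a := (C : ℝ≥0∞)) h1 (Or.inr ENNReal.coe_ne_top)
    simp only [mul_zero, zero_mul, ENNReal.ofReal_zero] at h2
    exact h2.mono_left nhdsWithin_le_nhds
  exact le_antisymm (ge_of_tendsto hlim (eventually_mem_nhdsWithin.mono fun η hη => key η hη))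
    bot_le

end Bulinskaya

/-! ### Product integrals, conditioning and averages over balls -/

theorem setLIntegral_pi_prod {n : ℕ} {J : Fin n → Set ℝ} {f : Fin n → ℝ → ℝ≥0∞}
    (hf : ∀ i, Measurable (f i)) :
    ∫⁻ t in univ.pi J, ∏ i, f i (t i) = ∏ i, ∫⁻ x in J i, f i x := by
  rw [volume_pi, Measure.restrict_pi_pi]
  induction n with
  | zero => simp
  | succ n ih =>
    have hm : Measurable fun t : Fin (n + 1) → ℝ => ∏ i, f i (t i) :=
      Finset.measurable_prod _ fun i _ => (hf i).comp (measurable_pi_apply i)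
    rw [← ((measurePreserving_piFinSuccAbove
      (fun i => (volume : Measure ℝ).restrict (J i)) 0).symm).lintegral_comp hm]
    simp_rw [MeasurableEquiv.piFinSuccAbove_symm_apply, Fin.insertNthEquiv,
      Fin.prod_univ_succ, Fin.insertNth_zero, Equiv.coe_fn_mk, Fin.cons_succ,
      Fin.zero_succAbove, cast_eq, Fin.cons_zero]
    have hm' : Measurable fun t : Fin n → ℝ => ∏ i, f i.succ (t i) :=
      Finset.measurable_prod _ fun i _ => (hf i.succ).comp (measurable_pi_apply i)
    rw [lintegral_prod_mul (hf 0).aemeasurable hm'.aemeasurable, ih fun i => hf i.succ]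

theorem setLIntegral_preimage_eq_of_isCondExpGiven {Ω E : Type*} [MeasurableSpace Ω]
    [MeasureSpace E] {P : Measure Ω} [IsFiniteMeasure P] {R : Ω → ℝ≥0∞} {V : Ω → E}
    {p e : E → ℝ≥0∞} (hV : Measurable V) (hp : IsDensity P V p) (he : IsCondExpGiven P R V e)
    {B : Set E} (hB : MeasurableSet B) :
    ∫⁻ ω in V ⁻¹' B, R ω ∂P = ∫⁻ v in B, e v * p v := by
  rw [← setLIntegral_condLExp hV.comap_le P R ⟨B, hB, rfl⟩,
    ← lintegral_congr_ae (ae_restrict_of_ae he.2),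
    ← setLIntegral_map hB he.1 hV, hp.2,
    setLIntegral_withDensity_eq_setLIntegral_mul _ hp.1 he.1 hB]
  simp only [Pi.mul_apply, mul_comm]

/-- Squeezing between constants works in `[0, ∞]`, so `B x = ∞` is allowed: finiteness of the Rice
function is a conclusion, not an assumption. -/
theorem tendsto_average_ball {E : Type*} [PseudoMetricSpace E] [MeasurableSpace E]
    [OpensMeasurableSpace E] {μ : Measure E} {x : E} {B : E → ℝ≥0∞} (hB : ContinuousAt B x)
    (h0 : ∀ δ > 0, μ (Metric.ball x δ) ≠ 0) (hfin : ∀ δ, μ (Metric.ball x δ) ≠ ∞) :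
    Tendsto (fun δ => (∫⁻ v in Metric.ball x δ, B v ∂μ) * (μ (Metric.ball x δ))⁻¹)
      (𝓝[>] 0) (𝓝 (B x)) := by
  have hball : ∀ s ∈ 𝓝 x, ∀ᶠ δ in 𝓝[>] (0 : ℝ), Metric.ball x δ ⊆ s := by
    intro s hs
    obtain ⟨ε, hε, h⟩ := Metric.mem_nhds_iff.1 hs
    filter_upwards [Ioo_mem_nhdsGT hε] with δ hδ using (Metric.ball_subset_ball hδ.2.le).trans h
  have hconst : ∀ c : ℝ≥0∞, ∀ δ > 0,
      (∫⁻ _ in Metric.ball x δ, c ∂μ) * (μ (Metric.ball x δ))⁻¹ = c := by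
    intro c δ hδ
    rw [setLIntegral_const, mul_assoc, ENNReal.mul_inv_cancel (h0 δ hδ) (hfin δ), mul_one]
  refine tendsto_order.2 ⟨fun c hc => ?_, fun c hc => ?_⟩
  · obtain ⟨c', hc1, hc2⟩ := exists_between hc
    filter_upwards [hball _ (hB.eventually_const_lt hc2), self_mem_nhdsWithin] with δ hδ hpos
    rw [← hconst c' δ hpos] at hc1
    refine hc1.trans_le ?_
    gcongr ?_ * _
    exact setLIntegral_mono' Metric.isOpen_ball.measurableSet fun v hv => (hδ hv).le
  · obtain ⟨c', hc1, hc2⟩ := exists_between hc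
    filter_upwards [hball _ (hB.eventually_lt_const hc1), self_mem_nhdsWithin] with δ hδ hpos
    rw [← hconst c' δ hpos] at hc2
    refine lt_of_le_of_lt ?_ hc2
    gcongr ?_ * _
    exact setLIntegral_mono' Metric.isOpen_ball.measurableSet fun v hv => (hδ hv).le

end Rice

/-! ### The formula on products of intervals -/

namespace Rice

variable {Ω : Type*} [MeasurableSpace Ω] {P : Measure Ω} {m : ℕ} {Y : ℝ → Ω → ℝ} {a b u : ℝ}
  {p e : (Fin m → ℝ) → (Fin m → ℝ) → ℝ≥0∞} {J : Fin m → Set ℝ}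

theorem exists_measurable_kacIntegrand (hab : a ≤ b) (hY : ∀ t ∈ Icc a b, Measurable (Y t))
    (hA1 : ∀ ω, ContDiffOn ℝ 1 (fun t => Y t ω) (Icc a b)) (u δ : ℝ) :
    ∃ φ : ℝ × Ω → ℝ≥0∞, Measurable φ ∧ ∀ t ∈ Icc a b, ∀ ω, φ (t, ω) =
      (Metric.ball u δ).indicator 1 (Y t ω) * ‖pathDeriv Y (Icc a b) ω t‖ₑ := by
  have h1 := measurable_uncurry_projIcc hab hY fun ω => (hA1 ω).continuousOn
  have h2 := measurable_uncurry_projIcc (X := fun t ω => pathDeriv Y (Icc a b) ω t) hab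
    (fun t ht => measurable_pathDeriv hY hA1 ht) (continuousOn_pathDeriv hA1)
  have h3 : Measurable ((Metric.ball u δ).indicator (1 : ℝ → ℝ≥0∞)) :=
    measurable_one.indicator Metric.isOpen_ball.measurableSet
  refine ⟨_, (h3.comp h1).mul h2.enorm, fun t ht ω => ?_⟩
  simp [Function.uncurry, projIcc_of_mem hab ht]

theorem measurable_kacIntegral (hab : a ≤ b) (hY : ∀ t ∈ Icc a b, Measurable (Y t))
    (hA1 : ∀ ω, ContDiffOn ℝ 1 (fun t => Y t ω) (Icc a b)) {J : Set ℝ} (hJ : MeasurableSet J)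
    (hJI : J ⊆ Icc a b) (δ : ℝ) :
    Measurable fun ω => kacIntegral (fun t => Y t ω) (pathDeriv Y (Icc a b) ω) u δ J := by
  obtain ⟨φ, hφ, hφeq⟩ := exists_measurable_kacIntegrand hab hY hA1 u δ
  have h : (fun ω => kacIntegral (fun t => Y t ω) (pathDeriv Y (Icc a b) ω) u δ J) =
      fun ω => ∫⁻ t in J, φ (t, ω) :=
    funext fun ω => setLIntegral_congr_fun hJ fun t ht => (hφeq t (hJI ht) ω).symm
  rw [h]
  exact hφ.lintegral_prod_left'

theorem lintegral_prod_kacIntegral [IsFiniteMeasure P] (hab : a ≤ b)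
    (hY : ∀ t ∈ Icc a b, Measurable (Y t))
    (hA1 : ∀ ω, ContDiffOn ℝ 1 (fun t => Y t ω) (Icc a b))
    (hpe : IsRiceVersion P Y (Icc a b) p e) (hJ : ∀ i, MeasurableSet (J i))
    (hJI : ∀ i, J i ⊆ Icc a b) {δ : ℝ} (hδ : 0 < δ) :
    ∫⁻ ω, ∏ i, kacIntegral (fun t => Y t ω) (pathDeriv Y (Icc a b) ω) u δ (J i) ∂P =
      ∫⁻ v in Metric.ball (fun _ => u) δ, riceFunction p e J v := by
  obtain ⟨φ, hφ, hφeq⟩ := exists_measurable_kacIntegrand hab hY hA1 u δ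
  have hpiJ : MeasurableSet (univ.pi J) := MeasurableSet.univ_pi hJ
  have hsub : univ.pi J ⊆ univ.pi fun _ : Fin m => Icc a b := pi_mono fun i _ => hJI i
  have hB : MeasurableSet (Metric.ball (fun _ : Fin m => u) δ) := Metric.isOpen_ball.measurableSet
  have h1 : ∀ ω, ∏ i, kacIntegral (fun t => Y t ω) (pathDeriv Y (Icc a b) ω) u δ (J i) =
      ∫⁻ t in univ.pi J, ∏ i, φ (t i, ω) := by
    intro ω
    rw [setLIntegral_pi_prod (f := fun _ t => φ (t, ω)) fun i => hφ.comp measurable_prodMk_right]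
    exact Finset.prod_congr rfl fun i _ =>
      setLIntegral_congr_fun (hJ i) fun t ht => (hφeq t (hJI i ht) ω).symm
  have h2 : Measurable fun z : Ω × (Fin m → ℝ) => ∏ i, φ (z.2 i, z.1) :=
    Finset.measurable_prod _ fun i _ =>
      hφ.comp (((measurable_pi_apply i).comp measurable_snd).prodMk measurable_fst)
  have h3 : Measurable fun z : (Fin m → ℝ) × (Fin m → ℝ) => e z.2 z.1 * p z.2 z.1 :=
    (hpe.measurable_condExp.mul hpe.measurable_density).comp measurable_swap
  simp_rw [h1, riceFunction]
  -- Tonelli on both sides reduces the claim to almost every fixed `t`, where the product of the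
  -- indicators is the indicator of a sup-norm ball.
  refine (lintegral_lintegral_swap h2.aemeasurable).trans
    (Eq.trans ?_ (lintegral_lintegral_swap h3.aemeasurable).symm)
  refine setLIntegral_congr_fun_ae hpiJ ?_
  have hI : MeasurableSet (univ.pi fun _ : Fin m => Icc a b) :=
    MeasurableSet.univ_pi fun _ => measurableSet_Icc
  filter_upwards [(ae_restrict_iff' hI).1 hpe.isDensity, (ae_restrict_iff' hI).1
    hpe.isCondExpGiven] with t hdt hct ht
  have htI : ∀ i, t i ∈ Icc a b := fun i => hsub ht i (mem_univ i)
  have hV : Measurable fun ω (i : Fin m) => Y (t i) ω :=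
    measurable_pi_lambda _ fun i => hY _ (htI i)
  rw [← setLIntegral_preimage_eq_of_isCondExpGiven hV (hdt (hsub ht)) (hct (hsub ht)) hB,
    ← lintegral_indicator (hV hB)]
  refine lintegral_congr fun ω => ?_
  rw [Finset.prod_congr rfl fun i _ => hφeq (t i) (htI i) ω, Finset.prod_mul_distrib]
  by_cases h : ∀ i, Y (t i) ω ∈ Metric.ball u δ
  · rw [indicator_of_mem]
    · simp [indicator_of_mem (h _)]
    · rw [mem_preimage, ball_pi _ hδ]
      exact fun i _ => h i
  · rw [indicator_of_notMem]
    · push Not at h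
      obtain ⟨i, hi⟩ := h
      rw [Finset.prod_eq_zero (Finset.mem_univ i) (indicator_of_notMem hi _), zero_mul]
    · rw [mem_preimage, ball_pi _ hδ]
      exact fun hcon => h fun i => hcon i (mem_univ i)

/-- The paths which are regular at the level `u`: they have finitely many critical points, and `u`
is not a critical value. -/
def IsRegularPath (f : ℝ → ℝ) (a b u : ℝ) : Prop :=
  levelCount (derivWithin f (Icc a b)) 0 (Icc a b) < ∞ ∧
    ∀ t ∈ Icc a b, f t = u → derivWithin f (Icc a b) t ≠ 0

theorem ae_isRegularPath (hab : a ≤ b) (hm : 0 < m) (hY : ∀ t ∈ Icc a b, Measurable (Y t))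
    (hA1 : ∀ ω, ContDiffOn ℝ 1 (fun t => Y t ω) (Icc a b))
    (hA2 : HasBoundedDensitiesNear P Y (Icc a b) u)
    (hA3 : ∫⁻ ω, levelCount (pathDeriv Y (Icc a b) ω) 0 (Icc a b) ^ m ∂P < ∞) :
    ∀ᵐ ω ∂P, IsRegularPath (fun t => Y t ω) a b u := by
  have hmeas := measurable_levelCount_zero (X := fun t ω => pathDeriv Y (Icc a b) ω t)
    (fun t ht => measurable_pathDeriv hY hA1 ht) (continuousOn_pathDeriv hA1)
  filter_upwards [ae_pathDeriv_ne_zero hab hY hA1 hA2, ae_lt_top (hmeas.pow_const m) hA3.ne]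
    with ω h1 h2
  exact ⟨(ENNReal.pow_lt_top_iff.1 h2).resolve_right hm.ne', h1⟩

/-- The frontier of a bounded interval has at most two points, and a law with a density has no
atoms. -/
theorem ae_ne_on_frontier (hY : ∀ t ∈ Icc a b, Measurable (Y t))
    (hA2 : HasBoundedDensitiesNear P Y (Icc a b) u) {J : Set ℝ} (hJ : J.OrdConnected)
    (hJI : J ⊆ Icc a b) : ∀ᵐ ω ∂P, ∀ t ∈ frontier J, Y t ω ≠ u := by
  obtain ⟨C, U, hU, hq⟩ := hA2
  have hfin : (frontier J).Finite :=
    (Set.toFinite _).subset (frontier_subset_of_ordConnected hJ hJI)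
  refine (ae_ball_iff hfin.countable).2 fun t ht => ?_
  have htI : t ∈ Icc a b := closure_minimal hJI isClosed_Icc (frontier_subset_closure ht)
  obtain ⟨q, hqd, _⟩ := hq t htI
  exact measure_eq_zero_iff_ae_notMem.1
    (measure_preimage_eq_zero_of_isDensity (hY t htI) hqd u)

theorem lintegral_add_one_pow_ne_top [IsFiniteMeasure P] {Z : Ω → ℝ≥0∞}
    (h : ∫⁻ ω, Z ω ^ m ∂P < ∞) : ∫⁻ ω, (Z ω + 1) ^ m ∂P ≠ ∞ := by
  have hle : ∀ x : ℝ≥0∞, (x + 1) ^ m ≤ 2 ^ m * (1 + x ^ m) := by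
    intro x
    rcases le_total x 1 with hx | hx
    · calc (x + 1) ^ m ≤ (1 + 1) ^ m := by gcongr
        _ = 2 ^ m * 1 := by rw [one_add_one_eq_two, mul_one]
        _ ≤ _ := by gcongr; exact le_self_add
    · calc (x + 1) ^ m ≤ (x + x) ^ m := by gcongr
        _ = 2 ^ m * x ^ m := by rw [← two_mul, mul_pow]
        _ ≤ _ := by gcongr; exact le_add_self
  refine ne_top_of_le_ne_top ?_ (lintegral_mono fun ω => hle (Z ω))
  rw [lintegral_const_mul' _ _ (by simp), lintegral_add_left measurable_const, lintegral_const]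
  exact ENNReal.mul_ne_top (by simp)
    (ENNReal.add_ne_top.2 ⟨by simp, h.ne⟩)

/-- The `m`-th Rice formula on products of intervals on which the Rice function is continuous. -/
theorem hasFiniteExpectation_prod_levelCount [IsFiniteMeasure P] (hm : 0 < m) (hab : a ≤ b)
    (hY : ∀ t ∈ Icc a b, Measurable (Y t))
    (hA1 : ∀ ω, ContDiffOn ℝ 1 (fun t => Y t ω) (Icc a b))
    (hA2 : HasBoundedDensitiesNear P Y (Icc a b) u)
    (hA3 : ∫⁻ ω, levelCount (pathDeriv Y (Icc a b) ω) 0 (Icc a b) ^ m ∂P < ∞)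
    (hpe : IsRiceVersion P Y (Icc a b) p e) (hJ : ∀ i, (J i).OrdConnected)
    (hJI : ∀ i, J i ⊆ Icc a b) (hc : ContinuousAt (riceFunction p e J) fun _ => u) :
    HasFiniteExpectation P (fun ω => ∏ i, levelCount (fun t => Y t ω) u (J i))
      (riceFunction p e J fun _ => u) := by
  have hJm : ∀ i, MeasurableSet (J i) := fun i => (hJ i).measurableSet
  set δ : ℕ → ℝ := fun n => 1 / ((n : ℝ) + 1) with hδdef
  have hδ : ∀ n, 0 < δ n := fun n => Nat.one_div_pos_of_nat
  have hδlim : Tendsto δ atTop (𝓝[>] 0) :=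
    tendsto_nhdsWithin_iff.2 ⟨tendsto_one_div_add_atTop_nhds_zero_nat, Eventually.of_forall hδ⟩
  have hpos : ∀ n, volume (Metric.ball u (δ n)) ≠ 0 := fun n =>
    (Metric.measure_ball_pos _ _ (hδ n)).ne'
  set F : ℕ → Ω → ℝ≥0∞ := fun n ω =>
    ∏ i, kacIntegral (fun t => Y t ω) (pathDeriv Y (Icc a b) ω) u (δ n) (J i) *
      (volume (Metric.ball u (δ n)))⁻¹ with hF
  have hFm : ∀ n, Measurable (F n) := fun n => Finset.measurable_prod _ fun i _ =>
    (measurable_kacIntegral hab hY hA1 (hJm i) (hJI i) _).mul_const _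
  have hreg := ae_isRegularPath hab hm hY hA1 hA2 hA3
  have hFlim : ∀ᵐ ω ∂P, Tendsto (fun n => F n ω) atTop
      (𝓝 (∏ i, levelCount (fun t => Y t ω) u (J i))) := by
    filter_upwards [hreg, ae_all_iff.2 fun i => ae_ne_on_frontier hY hA2 (hJ i) (hJI i)]
      with ω hω hfr
    refine tendsto_const_nhds.congr' ?_
    filter_upwards [eventually_all.2 fun i => hδlim.eventually (eventually_kacIntegral_eq (hA1 ω)
      hω.1 hω.2 (hJ i) (hJI i) (hfr i))] with n hn
    refine Finset.prod_congr rfl fun i _ => ?_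
    have h := hn i
    change kacIntegral _ (pathDeriv Y (Icc a b) ω) _ _ _ = _ at h
    rw [h, mul_assoc, ENNReal.mul_inv_cancel (hpos n) measure_ball_lt_top.ne, mul_one]
  -- The dominating function does not depend on `n`; A3 makes it integrable.
  have hFle : ∀ n, F n ≤ᵐ[P] fun ω =>
      (levelCount (pathDeriv Y (Icc a b) ω) 0 (Icc a b) + 1) ^ m := by
    intro n
    filter_upwards [hreg] with ω hω
    refine (Finset.prod_le_pow_card _ _ (levelCount (pathDeriv Y (Icc a b) ω) 0 (Icc a b) + 1)
      fun i _ => ?_).trans (by simp)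
    rw [← div_eq_mul_inv]
    exact ENNReal.div_le_of_le_mul (kacIntegral_le (hA1 ω) hω.1 (hJm i) (hJI i))
  have hbound := lintegral_add_one_pow_ne_top hA3
  have hFint : ∀ n, ∫⁻ ω, F n ω ∂P =
      (∫⁻ v in Metric.ball (fun _ => u) (δ n), riceFunction p e J v) *
        (volume (Metric.ball (fun _ : Fin m => u) (δ n)))⁻¹ := by
    intro n
    rw [← lintegral_prod_kacIntegral hab hY hA1 hpe hJm hJI (hδ n)]
    simp only [hF, Finset.prod_mul_distrib]
    rw [lintegral_mul_const]
    · congr 1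
      rw [volume_pi_ball _ (hδ n), Finset.prod_const, Finset.prod_const, ENNReal.inv_pow]
    · exact Finset.measurable_prod _ fun i _ =>
        measurable_kacIntegral hab hY hA1 (hJm i) (hJI i) _
  have hlim1 := tendsto_lintegral_of_dominated_convergence _ hFm hFle hbound hFlim
  have hlim2 : Tendsto (fun n => ∫⁻ ω, F n ω ∂P) atTop (𝓝 (riceFunction p e J fun _ => u)) := by
    simp_rw [hFint]
    exact (tendsto_average_ball hc (fun δ hδ => (Metric.measure_ball_pos _ _ hδ).ne')
      fun δ => measure_ball_lt_top.ne).comp hδlim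
  have heq := tendsto_nhds_unique hlim1 hlim2
  refine ⟨aemeasurable_of_tendsto_metrizable_ae atTop (fun n => (hFm n).aemeasurable) hFlim, heq,
    ?_⟩
  exact (le_of_tendsto hlim2 (Eventually.of_forall fun n => lintegral_mono_ae (hFle n))).trans_lt
    hbound.lt_top

end Rice

/-! ### Factorial moments by dyadic separation -/

namespace Rice

/-- The tuples whose coordinates lie in pairwise distinct dyadic intervals of length `2 ^ (-N)`. -/
def separatedTuples (m N : ℕ) : Set (Fin m → ℝ) :=
  {t | Function.Injective fun i => ⌊2 ^ N * t i⌋}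

theorem pi_inter_separatedTuples (m N : ℕ) (A : Set ℝ) :
    (univ.pi fun _ : Fin m => A) ∩ separatedTuples m N =
      ⋃ σ : Fin m ↪ ℤ, univ.pi fun i => A ∩ dyadicCell N (σ i) := by
  ext t
  simp only [mem_inter_iff, Set.mem_pi, mem_univ, true_imp_iff, mem_iUnion, forall_and]
  constructor
  · rintro ⟨hA, ht⟩
    exact ⟨⟨_, ht⟩, hA, fun i => rfl⟩
  · rintro ⟨σ, hA, hσ⟩
    refine ⟨hA, fun i j hij => σ.injective ?_⟩
    exact (hσ i).symm.trans (Eq.trans hij (hσ j))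

theorem monotone_separatedTuples (m : ℕ) : Monotone (separatedTuples m) :=
  monotone_nat_of_le_succ fun _ _ ht _ _ hij => ht (floor_dyadic_of_succ hij)

theorem iUnion_separatedTuples (m : ℕ) :
    ⋃ N, separatedTuples m N = {t | Function.Injective t} := by
  ext t
  rw [mem_iUnion]
  constructor
  · rintro ⟨N, hN⟩ i j hij
    exact hN (by simp only [hij])
  · exact fun ht => (eventually_injective_floor_dyadic ht).exists

variable {m : ℕ}

/-- Used twice: with counting measure for tuples of crossings, and with the measure whose density is
the Rice integrand. -/
theorem tsum_measure_pi_dyadicCell (ν : Measure (Fin m → ℝ)) {A : Set ℝ} (hA : MeasurableSet A)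
    (N : ℕ) : ∑' σ : Fin m ↪ ℤ, ν (univ.pi fun i => A ∩ dyadicCell N (σ i)) =
      ν ((univ.pi fun _ => A) ∩ separatedTuples m N) := by
  rw [pi_inter_separatedTuples, measure_iUnion]
  · intro σ τ hστ
    obtain ⟨i, hi⟩ := DFunLike.exists_ne hστ
    refine Set.disjoint_left.2 fun t ht1 ht2 => ?_
    exact Set.disjoint_left.1 (disjoint_dyadicCell N hi) (ht1 i (mem_univ i)).2
      (ht2 i (mem_univ i)).2
  · exact fun σ => MeasurableSet.univ_pi fun i =>
      hA.inter (ordConnected_dyadicCell N (σ i)).measurableSet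

theorem tendsto_measure_separatedTuples (ν : Measure (Fin m → ℝ)) (A : Set ℝ) :
    Tendsto (fun N => ν ((univ.pi fun _ => A) ∩ separatedTuples m N)) atTop
      (𝓝 (ν ((univ.pi fun _ => A) ∩ {t | Function.Injective t}))) := by
  rw [← iUnion_separatedTuples, inter_iUnion]
  exact tendsto_measure_iUnion_atTop fun N M hNM =>
    inter_subset_inter_right _ (monotone_separatedTuples m hNM)

/-- Each diagonal `tᵢ = tⱼ`, `i ≠ j`, is a proper subspace. -/
theorem ae_injective (m : ℕ) : ∀ᵐ t : Fin m → ℝ, Function.Injective t := by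
  have h : ∀ i j : Fin m, ∀ᵐ t : Fin m → ℝ, t i = t j → i = j := by
    intro i j
    by_cases hij : i = j
    · simp [hij]
    · set L : (Fin m → ℝ) →ₗ[ℝ] ℝ := (LinearMap.proj i : (Fin m → ℝ) →ₗ[ℝ] ℝ) -
        (LinearMap.proj j : (Fin m → ℝ) →ₗ[ℝ] ℝ) with hL
      have hne : LinearMap.ker L ≠ ⊤ := by
        intro hcon
        have : Pi.single i (1 : ℝ) ∈ LinearMap.ker L := hcon ▸ Submodule.mem_top
        simp [hL, Ne.symm hij] at this
      filter_upwards [measure_eq_zero_iff_ae_notMem.1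
        (Measure.addHaar_submodule volume _ hne)] with t ht heq
      exact absurd (by simp [hL, heq]) ht
  filter_upwards [ae_all_iff.2 fun i => ae_all_iff.2 (h i)] with t ht i j hij using ht i j hij

/-- Injective tuples in `A` are embeddings `Fin m ↪ A`, counted by the descending factorial. -/
theorem encard_pi_inter_injective {A : Set ℝ} (hA : A.Finite) :
    ((((univ.pi fun _ : Fin m => A) ∩ {t | Function.Injective t}).encard : ℕ∞) : ℝ≥0∞) =
      fallingFactorial (A.encard : ℝ≥0∞) m := by
  have := hA.fintype
  have hrange : (univ.pi fun _ : Fin m => A) ∩ {t | Function.Injective t} =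
      range fun (τ : Fin m ↪ A) (i : Fin m) => (τ i : ℝ) := by
    ext t
    constructor
    · rintro ⟨htA, ht⟩
      exact ⟨⟨fun i => ⟨t i, htA i (mem_univ i)⟩, fun i j hij => ht (congrArg Subtype.val hij)⟩, rfl⟩
    · rintro ⟨τ, rfl⟩
      exact ⟨fun i _ => (τ i).2, Subtype.val_injective.comp τ.injective⟩
  have hinj : Function.Injective fun (τ : Fin m ↪ A) (i : Fin m) => (τ i : ℝ) := by
    intro τ τ' h
    ext i
    exact congrFun h i
  rw [hrange, ← image_univ, hinj.encard_image, encard_univ, ENat.card_eq_coe_fintype_card,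
    Fintype.card_embedding_eq, Fintype.card_fin, ← ENat.card_coe_set_eq,
    ENat.card_eq_coe_fintype_card, Nat.descFactorial_eq_prod_range, fallingFactorial]
  rw [ENat.toENNReal_coe, Nat.cast_prod]
  simp only [ENat.toENNReal_coe, ENNReal.natCast_sub]

variable {Ω : Type*} [MeasurableSpace Ω] {P : Measure Ω} {Y : ℝ → Ω → ℝ} {a b u : ℝ}
  {p e : (Fin m → ℝ) → (Fin m → ℝ) → ℝ≥0∞}

theorem tendsto_tsum_riceFunction {A : Set ℝ} (hA : MeasurableSet A) (v : Fin m → ℝ) :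
    Tendsto (fun N => ∑' σ : Fin m ↪ ℤ,
      riceFunction p e (fun i => A ∩ dyadicCell N (σ i)) v) atTop
      (𝓝 (riceFunction p e (fun _ => A) v)) := by
  set ν : Measure (Fin m → ℝ) := volume.withDensity fun t => e t v * p t v with hν
  have hrice : ∀ J : Fin m → Set ℝ, (∀ i, MeasurableSet (J i)) →
      riceFunction p e J v = ν (univ.pi J) := fun J hJ =>
    (withDensity_apply _ (MeasurableSet.univ_pi hJ)).symm
  have h1 : ν ((univ.pi fun _ => A) ∩ {t | Function.Injective t}) =
      riceFunction p e (fun _ => A) v := by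
    rw [hrice _ fun _ => hA]
    exact measure_congr (inter_ae_eq_left_of_ae_eq_univ (eventuallyEq_univ.2
      ((withDensity_absolutelyContinuous _ _).ae_le (ae_injective m))))
  rw [← h1]
  refine (tendsto_measure_separatedTuples ν A).congr fun N => ?_
  rw [← tsum_measure_pi_dyadicCell ν hA]
  exact tsum_congr fun σ => (hrice _ fun i =>
    hA.inter (ordConnected_dyadicCell N (σ i)).measurableSet).symm

theorem tsum_prod_levelCount {f : ℝ → ℝ} {I : Set ℝ} (hfin : {t ∈ I | f t = u}.Finite) (N : ℕ) :
    ∑' σ : Fin m ↪ ℤ, ∏ i, levelCount f u (I ∩ dyadicCell N (σ i)) =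
      Measure.count ((univ.pi fun _ : Fin m => {t ∈ I | f t = u}) ∩ separatedTuples m N) := by
  rw [← tsum_measure_pi_dyadicCell _ hfin.measurableSet]
  refine tsum_congr fun σ => ?_
  rw [Measure.count_apply (MeasurableSet.univ_pi fun i =>
    hfin.measurableSet.inter (ordConnected_dyadicCell N (σ i)).measurableSet),
    encard_pi_eq_prod_encard]
  have hcast := map_prod ENat.toENNRealRingHom
    (fun i => ({t ∈ I | f t = u} ∩ dyadicCell N (σ i)).encard) Finset.univ
  refine Eq.trans (Finset.prod_congr rfl fun i _ => ?_) hcast.symm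
  have : {t ∈ I ∩ dyadicCell N (σ i) | f t = u} = {t ∈ I | f t = u} ∩ dyadicCell N (σ i) := by
    ext t
    simp only [mem_ofPred_eq, mem_inter_iff]
    tauto
  rw [levelCount, this]
  rfl

/-- The `m`-th Rice formula for the factorial moment. -/
theorem hasFiniteExpectation_fallingFactorial [IsFiniteMeasure P] (hm : 0 < m) (hab : a ≤ b)
    (hY : ∀ t ∈ Icc a b, Measurable (Y t))
    (hA1 : ∀ ω, ContDiffOn ℝ 1 (fun t => Y t ω) (Icc a b))
    (hA2 : HasBoundedDensitiesNear P Y (Icc a b) u)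
    (hA3 : ∫⁻ ω, levelCount (pathDeriv Y (Icc a b) ω) 0 (Icc a b) ^ m ∂P < ∞)
    (hprod : ∀ J : Fin m → Set ℝ, AreDisjointIntervals (Icc a b) J →
      HasFiniteExpectation P (fun ω => ∏ i, levelCount (fun t => Y t ω) u (J i))
        (riceFunction p e J fun _ => u)) :
    HasFiniteExpectation P
      (fun ω => fallingFactorial (levelCount (fun t => Y t ω) u (Icc a b)) m)
      (riceFunction p e (fun _ => Icc a b) fun _ => u) := by
  -- Injectivity of `σ` makes the cells disjoint, so (i) applies.
  have hcell : ∀ (N : ℕ) (σ : Fin m ↪ ℤ), HasFiniteExpectation P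
      (fun ω => ∏ i, levelCount (fun t => Y t ω) u (Icc a b ∩ dyadicCell N (σ i)))
      (riceFunction p e (fun i => Icc a b ∩ dyadicCell N (σ i)) fun _ => u) := fun N σ =>
    hprod _ ⟨fun i => ordConnected_Icc.inter (ordConnected_dyadicCell N (σ i)),
      fun i => inter_subset_left, fun i j hij =>
        (disjoint_dyadicCell N (σ.injective.ne hij)).mono inter_subset_right inter_subset_right⟩
  set G : ℕ → Ω → ℝ≥0∞ := fun N ω => ∑' σ : Fin m ↪ ℤ,
    ∏ i, levelCount (fun t => Y t ω) u (Icc a b ∩ dyadicCell N (σ i)) with hG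
  have hGm : ∀ N, AEMeasurable (G N) P := fun N => AEMeasurable.tsum fun σ => (hcell N σ).1
  have hGint : ∀ N, ∫⁻ ω, G N ω ∂P = ∑' σ : Fin m ↪ ℤ,
      riceFunction p e (fun i => Icc a b ∩ dyadicCell N (σ i)) fun _ => u := fun N => by
    rw [lintegral_tsum fun σ => (hcell N σ).1]
    exact tsum_congr fun σ => (hcell N σ).2.1
  have hle : ∀ᵐ ω ∂P, levelCount (fun t => Y t ω) u (Icc a b) ≤
        levelCount (pathDeriv Y (Icc a b) ω) 0 (Icc a b) + 1 ∧
      levelCount (pathDeriv Y (Icc a b) ω) 0 (Icc a b) < ∞ := by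
    filter_upwards [ae_isRegularPath hab hm hY hA1 hA2 hA3,
      ae_ne_on_frontier hY hA2 ordConnected_Icc Subset.rfl] with ω hω hfr
    exact ⟨levelCount_le (hA1 ω) hω.1 hω.2 ordConnected_Icc Subset.rfl hfr, hω.1⟩
  have hfin : ∀ᵐ ω ∂P, {t ∈ Icc a b | Y t ω = u}.Finite := by
    filter_upwards [hle] with ω hω
    rw [← encard_lt_top_iff]
    have : levelCount (fun t => Y t ω) u (Icc a b) < ∞ :=
      hω.1.trans_lt (ENNReal.add_lt_top.2 ⟨hω.2, ENNReal.one_lt_top⟩)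
    simpa [levelCount] using this
  have hGmono : ∀ᵐ ω ∂P, Monotone fun N => G N ω := by
    filter_upwards [hfin] with ω hω N M hNM
    simp only [hG, tsum_prod_levelCount hω]
    exact measure_mono (inter_subset_inter_right _ (monotone_separatedTuples m hNM))
  have hGlim : ∀ᵐ ω ∂P, Tendsto (fun N => G N ω) atTop
      (𝓝 (fallingFactorial (levelCount (fun t => Y t ω) u (Icc a b)) m)) := by
    filter_upwards [hfin] with ω hω
    simp only [hG, tsum_prod_levelCount hω]
    have hpi : (univ.pi fun _ : Fin m => {t ∈ Icc a b | Y t ω = u}).Finite :=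
      Set.Finite.pi fun _ => hω
    rw [levelCount, ← encard_pi_inter_injective hω,
      ← Measure.count_apply (hpi.subset inter_subset_left).measurableSet]
    exact tendsto_measure_separatedTuples _ _
  have hlim1 := lintegral_tendsto_of_tendsto_of_monotone hGm hGmono hGlim
  have hlim2 := tendsto_tsum_riceFunction (p := p) (e := e)
    (measurableSet_Icc (a := a) (b := b)) fun _ => u
  simp_rw [hGint] at hlim1
  have heq := tendsto_nhds_unique hlim1 hlim2
  refine ⟨aemeasurable_of_tendsto_metrizable_ae atTop hGm hGlim, heq, ?_⟩
  rw [← heq]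
  -- Each truncated factor is at most the crossing count, itself at most the number of critical
  -- points plus one.
  refine (lintegral_mono_ae (hle.mono fun ω hω => ?_)).trans_lt
    (lintegral_add_one_pow_ne_top hA3).lt_top
  refine (Finset.prod_le_pow_card _ _
    (levelCount (pathDeriv Y (Icc a b) ω) 0 (Icc a b) + 1) fun k _ => ?_).trans (by simp)
  exact tsub_le_self.trans hω.1

end Rice

theorem proposition3p5 {Ω : Type*} [MeasurableSpace Ω] (P : Measure Ω) [IsProbabilityMeasure P]
    (m : ℕ) (hm : 0 < m) (a b : ℝ) (hab : a ≤ b) (u : ℝ)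
    (Y : ℝ → Ω → ℝ) (hY : ∀ t ∈ Icc a b, Measurable (Y t))
    (hA1 : ∀ ω, ContDiffOn ℝ 1 (fun t => Y t ω) (Icc a b))
    (hA2 : Rice.HasBoundedDensitiesNear P Y (Icc a b) u)
    (hA3 : ∫⁻ ω, Rice.levelCount (Rice.pathDeriv Y (Icc a b) ω) 0 (Icc a b) ^ m ∂P < ∞)
    (p e : (Fin m → ℝ) → (Fin m → ℝ) → ℝ≥0∞)
    (hpe : Rice.IsRiceVersion P Y (Icc a b) p e)
    (hA4 : ∀ J : Fin m → Set ℝ, Rice.AreDisjointIntervals (Icc a b) J →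
      ContinuousAt (Rice.riceFunction p e J) (fun _ => u)) :
    (∀ J : Fin m → Set ℝ, Rice.AreDisjointIntervals (Icc a b) J →
      Rice.HasFiniteExpectation P (fun ω => ∏ i, Rice.levelCount (fun t => Y t ω) u (J i))
        (Rice.riceFunction p e J (fun _ => u))) ∧
    Rice.HasFiniteExpectation P
      (fun ω => Rice.fallingFactorial (Rice.levelCount (fun t => Y t ω) u (Icc a b)) m)
      (Rice.riceFunction p e (fun _ => Icc a b) (fun _ => u)) := by
  have hprod : ∀ J : Fin m → Set ℝ, Rice.AreDisjointIntervals (Icc a b) J →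
      Rice.HasFiniteExpectation P (fun ω => ∏ i, Rice.levelCount (fun t => Y t ω) u (J i))
        (Rice.riceFunction p e J (fun _ => u)) := fun J hJ =>
    Rice.hasFiniteExpectation_prod_levelCount hm hab hY hA1 hA2 hA3 hpe hJ.1 hJ.2.1 (hA4 J hJ)
  exact ⟨hprod, Rice.hasFiniteExpectation_fallingFactorial hm hab hY hA1 hA2 hA3 hprod⟩
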